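/- Let $n, m \ge 0$ and let $\mathcal P_n=\{\sigma_1\otimes\cdots\otimes\sigma_n : \sigma_i\in\{I,X,Y,Z\}\}$ be the set of $n$-qubit Pauli operators. For $P\in\pm\mathcal P_n$ put $$R(P)=\frac{1+e^{i\pi/4}}{2}\,I+\frac{1-e^{i\pi/4}}{2}\,P .$$ A Clifford+$T$ circuit is a finite sequence of gates $H$, $S$, $\mathrm{CNOT}$, $T$ on specified qubits. Its $T$-depth is the least number of $T$-cycles (layers of simultaneous $T$ gates on distinct qubits, with only Clifford gates between consecutive layers) into which its $T$ gates can be grouped, where gates acting on disjoint sets of qubits may be reordered. Let $P_1,\dots,P_m\in\pm\mathcal P_n$ commute pairwise. Then there is a Clifford+$T$ circuit on $n+m$ qubits ($n$ data qubits and $m$ ancilla qubits) of $T$-depth $1$ (of $T$-depth $0$ if $m=0$) that implements exactly the operator $$U'=\prod_{j=1}^m R(P_j\otimes Z_j),$$ where $Z_j$ is the Pauli $Z$ on the $j$-th ancilla, and that therefore realizes $\prod_{j=1}^m R(P_j)$ with the ancillas starting in, and returning to, $|0\rangle^{\otimes m}$: $$U'\bigl(|\psi\rangle\otimes|0\rangle^{\otimes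 m}\bigr)=\Bigl(\prod_{j=1}^m R(P_j)\,|\psi\rangle\Bigr)\otimes|0\rangle^{\otimes m}\qquad\text{for every } n\text{-qubit state } |\psi\rangle .$$ No condition on products of the $P_j$ being different from $\pm I$ is required. -/

import Mathlib

open scoped Matrix

noncomputable section

namespace CliffordT

/-- The computational basis of a register whose qubits are labelled by `ι`. -/
abbrev Basis (ι : Type) : Type := ι → Fin 2

/-- Operators on the state space `(ℂ²)^{⊗ι}`, as matrices in the computational basis. -/
abbrev Op (ι : Type) : Type := Matrix (Basis ι) (Basis ι) ℂ

/-- The state space `(ℂ²)^{⊗ι}`, by coordinates in the computational basis. -/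
abbrev Ket (ι : Type) : Type := Basis ι → ℂ

/-- The single-qubit Pauli labels. -/
inductive Pauli : Type
  | I | X | Y | Z

/-- The single-qubit Pauli matrices. -/
def Pauli.matrix : Pauli → Matrix (Fin 2) (Fin 2) ℂ
  | .I => 1
  | .X => !![0, 1; 1, 0]
  | .Y => !![0, -Complex.I; Complex.I, 0]
  | .Z => !![1, 0; 0, -1]

/-- The Hadamard matrix. -/
def matH : Matrix (Fin 2) (Fin 2) ℂ := (1 / (Real.sqrt 2 : ℂ)) • !![1, 1; 1, -1]

/-- The phase matrix. -/
def matS : Matrix (Fin 2) (Fin 2) ℂ := !![1, 0; 0, Complex.I]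

/-- The scalar `e^{iπ/4}`. -/
def omega : ℂ := Complex.exp (Complex.I * (Real.pi / 4))

/-- The `T` matrix `|0⟩⟨0| + e^{iπ/4} |1⟩⟨1|`. -/
def matT : Matrix (Fin 2) (Fin 2) ℂ := !![1, 0; 0, omega]

section Register

variable {ι : Type} [Fintype ι] [DecidableEq ι]

/-- The tensor product `⨂ᵢ σ i` of single-qubit operators. -/
def tensorAll (σ : ι → Matrix (Fin 2) (Fin 2) ℂ) : Op ι :=
  fun x y => ∏ i, σ i (x i) (y i)

/-- The single-qubit operator `A` acting on qubit `q`, and the identity on the other qubits. -/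
def onQubit (q : ι) (A : Matrix (Fin 2) (Fin 2) ℂ) : Op ι :=
  tensorAll (Function.update (fun _ => 1) q A)

variable (ι) in
/-- The set `𝒫` of (unsigned) Pauli operators `⨂ᵢ σᵢ` with `σᵢ ∈ {I, X, Y, Z}`. -/
def paulis : Set (Op ι) := {P | ∃ s : ι → Pauli, P = tensorAll fun i => (s i).matrix}

variable (ι) in
/-- The set `±𝒫` of signed Pauli operators; it contains `I` and `-I`. -/
def signedPaulis : Set (Op ι) := {P | P ∈ paulis ι ∨ -P ∈ paulis ι}

/-- The `π/4` rotation `R(P) = (1 + e^{iπ/4})/2 · I + (1 - e^{iπ/4})/2 · P`. -/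
def R (P : Op ι) : Op ι := ((1 + omega) / 2) • (1 : Op ι) + ((1 - omega) / 2) • P

/-- The gates of the Clifford+`T` gate set, with the qubits on which they act. -/
inductive Gate (ι : Type) : Type
  | H (q : ι)
  | S (q : ι)
  | CNOT (control target : ι) (ne : control ≠ target)
  | T (q : ι)

/-- The operator implemented by a gate;
`CNOT` is `|0⟩⟨0| ⊗ I + |1⟩⟨1| ⊗ X` on the control and the target. -/
def Gate.op : Gate ι → Op ι
  | .H q => onQubit q matH
  | .S q => onQubit q matS
  | .CNOT a b _ => onQubit a !![1, 0; 0, 0] + onQubit a !![0, 0; 0, 1] * onQubit b Pauli.X.matrix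
  | .T q => onQubit q matT

/-- A Clifford+`T` circuit is a finite sequence of gates, written in the order of the operator
product, so that the last gate of the list acts first. -/
abbrev Circuit (ι : Type) : Type := List (Gate ι)

/-- The operator implemented by a circuit. -/
def Circuit.op (c : Circuit ι) : Op ι := (List.map Gate.op c).prod

end Register

section Depth

variable {ι : Type}

/-- The set of qubits on which a gate acts. -/
def Gate.support : Gate ι → Set ι
  | .H q => {q}
  | .S q => {q}
  | .CNOT a b _ => {a, b}
  | .T q => {q}

/-- A gate of the Clifford gate set `H`, `S`, `CNOT`. -/
def Gate.IsClifford : Gate ι → Prop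
  | .T _ => False
  | _ => True

/-- Exchange of two neighbouring gates that act on disjoint sets of qubits. -/
inductive SwapStep : Circuit ι → Circuit ι → Prop
  | swap (a b : Circuit ι) (g h : Gate ι) (disj : Disjoint g.support h.support) :
      SwapStep (a ++ g :: h :: b) (a ++ h :: g :: b)

/-- Two gate lists describe the same circuit when they differ only in the order in which gates
on disjoint sets of qubits are listed. -/
def SameCircuit (c d : Circuit ι) : Prop := Relation.ReflTransGen SwapStep c d

/-- A `T`-cycle: simultaneous `T` gates on distinct qubits. -/
def IsTCycle (c : Circuit ι) : Prop := ∃ qs : List ι, qs.Nodup ∧ c = qs.map Gate.T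

/-- `Layered k c`: the gate list `c` has the form `C₀ L₁ C₁ L₂ ⋯ L_k C_k`, where each `Cᵢ` consists
of Clifford gates and each `Lᵢ` is a `T`-cycle. -/
inductive Layered : ℕ → Circuit ι → Prop
  | clifford (C : Circuit ι) (hC : ∀ g ∈ C, g.IsClifford) : Layered 0 C
  | layer (k : ℕ) (C L c : Circuit ι) (hC : ∀ g ∈ C, g.IsClifford) (hL : IsTCycle L)
      (hc : Layered k c) : Layered (k + 1) (C ++ L ++ c)

/-- The `T`-depth of a circuit: the least number of `T`-cycles into which its `T` gates
can be grouped. -/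
def Circuit.tDepth (c : Circuit ι) : ℕ := sInf {k | ∃ d, SameCircuit c d ∧ Layered k d}

/-- Every circuit has a grouping into `T`-cycles, so the `T`-depth is an attained minimum. -/
theorem exists_layered (c : Circuit ι) : ∃ k d, SameCircuit c d ∧ Layered k d := by
  suffices h : ∃ k, Layered k c from
    let ⟨k, hk⟩ := h
    ⟨k, c, Relation.ReflTransGen.refl, hk⟩
  induction c with
  | nil => exact ⟨0, .clifford [] (by simp)⟩
  | cons g c ih =>
    obtain ⟨k, hk⟩ := ih
    by_cases hg : g.IsClifford
    · exact ⟨k + 1, .layer k [g] [] c (by simpa using hg) ⟨[], by simp, rfl⟩ hk⟩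
    · cases g with
      | T q => exact ⟨k + 1, .layer k [] [.T q] c (by simp) ⟨[q], by simp, rfl⟩ hk⟩
      | _ => exact absurd trivial hg

end Depth

section Ancilla

variable {α β : Type}

/-- The tensor product of two operators, on the union of two registers. -/
def tensorOp (A : Op α) (B : Op β) : Op (α ⊕ β) :=
  fun x y => A (x ∘ Sum.inl) (y ∘ Sum.inl) * B (x ∘ Sum.inr) (y ∘ Sum.inr)

/-- The tensor product of two states, on the union of two registers. -/
def tensorKet (ψ : Ket α) (φ : Ket β) : Ket (α ⊕ β) :=
  fun x => ψ (x ∘ Sum.inl) * φ (x ∘ Sum.inr)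

/-- The state `|0⟩^{⊗β}`. -/
def ketZero [Fintype β] : Ket β := Pi.single (fun _ => 0) 1

end Ancilla

end CliffordT

end

namespace CliffordT

/-! ### Calculus of tensor products and one-qubit operators. -/

section Register

variable {ι : Type} [Fintype ι] [DecidableEq ι]

/-! Conjugation commutes with `R` (`R_conj`) and `R(Z_q)` is a `T` gate on `q` (`R_onQubit_Z`). So
it suffices to find one Clifford `C` that sends every ancilla operator `Z_j` to `P_j ⊗ Z_j`: then
`U' = C (∏ T_j) C⁻¹`, a single `T`-cycle on distinct ancillas. Such a `C` is a product of the
self-inverse gates `H_k · ctrl_k(P_k) · H_k` (`ctrlX`). The `k`-th one sends `Z_k` to `P_k Z_k`. It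
fixes `Z_j` for `j ≠ k`, which lives on another ancilla, and fixes `P_j`, because the Paulis
commute. Induction gives `exists_clifford_conj`. The ancilla `Z_j` are independent whatever
relations hold among the `P_j`, so none need be excluded. The action on states follows since `Z_j`
fixes `|0⟩`. The depth is positive for `m > 0` because reordering cannot remove a `T` gate. -/

theorem tensorAll_mul (σ τ : ι → Matrix (Fin 2) (Fin 2) ℂ) :
    tensorAll σ * tensorAll τ = tensorAll (fun i => σ i * τ i) := by
  ext x y
  simp only [tensorAll, Matrix.mul_apply, ← Finset.prod_mul_distrib]
  exact (Fintype.prod_sum fun i k => σ i (x i) k * τ i k (y i)).symm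

theorem tensorAll_one : tensorAll (fun _ : ι => (1 : Matrix (Fin 2) (Fin 2) ℂ)) = 1 := by
  ext x y
  by_cases h : x = y
  · subst h
    simp [tensorAll]
  · obtain ⟨i, hi⟩ := Function.ne_iff.1 h
    rw [Matrix.one_apply_ne h]
    exact Finset.prod_eq_zero (Finset.mem_univ i) (Matrix.one_apply_ne hi)

theorem onQubit_one (q : ι) : onQubit q 1 = 1 := by
  rw [onQubit, Function.update_eq_self_iff.2 rfl, tensorAll_one]

theorem onQubit_mul (q : ι) (A B : Matrix (Fin 2) (Fin 2) ℂ) :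
    onQubit q A * onQubit q B = onQubit q (A * B) := by
  rw [onQubit, onQubit, onQubit, tensorAll_mul]
  congr 1
  ext1 i
  by_cases h : i = q
  · subst h
    simp
  · simp [h]

theorem onQubit_apply (q : ι) (A : Matrix (Fin 2) (Fin 2) ℂ) (x y : Basis ι) :
    onQubit q A x y = A (x q) (y q) *
      ∏ i ∈ Finset.univ.erase q, (1 : Matrix (Fin 2) (Fin 2) ℂ) (x i) (y i) := by
  rw [onQubit, tensorAll, ← Finset.mul_prod_erase _ _ (Finset.mem_univ q), Function.update_self]
  congr 1
  refine Finset.prod_congr rfl fun i hi => ?_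
  rw [Function.update_of_ne (Finset.ne_of_mem_erase hi)]

theorem onQubit_add (q : ι) (A B : Matrix (Fin 2) (Fin 2) ℂ) :
    onQubit q (A + B) = onQubit q A + onQubit q B := by
  ext x y
  simp only [Matrix.add_apply, onQubit_apply, add_mul]

theorem onQubit_smul (q : ι) (r : ℂ) (A : Matrix (Fin 2) (Fin 2) ℂ) :
    onQubit q (r • A) = r • onQubit q A := by
  ext x y
  simp only [Matrix.smul_apply, onQubit_apply, smul_eq_mul, mul_assoc]

theorem onQubit_zero (q : ι) : onQubit q 0 = 0 := by
  ext x y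
  simp [onQubit_apply]

theorem commute_tensorAll_onQubit {σ : ι → Matrix (Fin 2) (Fin 2) ℂ} {q : ι} (h : σ q = 1)
    (A : Matrix (Fin 2) (Fin 2) ℂ) : Commute (tensorAll σ) (onQubit q A) := by
  rw [Commute, SemiconjBy, onQubit, tensorAll_mul, tensorAll_mul]
  congr 1
  ext1 i
  by_cases hi : i = q
  · subst hi
    simp [h]
  · simp [hi]

theorem commute_onQubit {p q : ι} (h : p ≠ q) (A B : Matrix (Fin 2) (Fin 2) ℂ) :
    Commute (onQubit p A) (onQubit q B) :=
  commute_tensorAll_onQubit (Function.update_of_ne h.symm _ _) B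

/-! ### Identities between 2 × 2 gate matrices. -/

theorem Pauli.matrix_mul_self (s : Pauli) : s.matrix * s.matrix = 1 := by
  cases s <;> ext i j <;> fin_cases i <;> fin_cases j <;> simp [Pauli.matrix]

theorem matH_mul_self : matH * matH = 1 := by
  have h : ((Real.sqrt 2 : ℂ))⁻¹ * (Real.sqrt 2 : ℂ)⁻¹ = 1 / 2 := by
    rw [← mul_inv, ← Complex.ofReal_mul, Real.mul_self_sqrt (by norm_num)]
    norm_num
  ext i j
  fin_cases i <;> fin_cases j <;> simp [matH, h] <;> norm_num

theorem matH_mul_X_mul_matH : matH * Pauli.X.matrix * matH = Pauli.Z.matrix := by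
  have h : ((Real.sqrt 2 : ℂ))⁻¹ * (Real.sqrt 2 : ℂ)⁻¹ = 1 / 2 := by
    rw [← mul_inv, ← Complex.ofReal_mul, Real.mul_self_sqrt (by norm_num)]
    norm_num
  ext i j
  fin_cases i <;> fin_cases j <;> simp [matH, Pauli.matrix, h] <;> norm_num

theorem matH_mul_Z_mul_matH : matH * Pauli.Z.matrix * matH = Pauli.X.matrix := by
  rw [← matH_mul_X_mul_matH]
  simp only [mul_assoc, matH_mul_self, mul_one]
  rw [← mul_assoc, matH_mul_self, one_mul]

theorem matS_mul_self : matS * matS = Pauli.Z.matrix := by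
  ext i j
  fin_cases i <;> fin_cases j <;> simp [matS, Pauli.matrix]

/-- The cube stands for `S⁻¹`, which is not itself in the gate set. -/
theorem matS_mul_X_mul_matS_cube : matS * Pauli.X.matrix * (matS * matS * matS) =
    Pauli.Y.matrix := by
  ext i j
  fin_cases i <;> fin_cases j <;> simp [matS, Pauli.matrix]

theorem matS_mul_matS_cube : matS * (matS * matS * matS) = 1 := by
  ext i j
  fin_cases i <;> fin_cases j <;> simp [matS]

/-! ### Controlled operators. -/

/-- The operator that applies `A` when the control qubit `a` is in the state `|1⟩`. -/
noncomputable def ctrl (a : ι) (A : Op ι) : Op ι :=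
  onQubit a !![1, 0; 0, 0] + onQubit a !![0, 0; 0, 1] * A

theorem ctrl_one (a : ι) : ctrl a 1 = 1 := by
  rw [ctrl, mul_one, ← onQubit_add, ← onQubit_one a]
  congr 1
  ext i j
  fin_cases i <;> fin_cases j <;> simp

/-- Phase kickback: this is how the sign of a Pauli is later paid for by Clifford gates. -/
theorem ctrl_neg_one (a : ι) : ctrl a (-1) = onQubit a Pauli.Z.matrix := by
  rw [ctrl, ← neg_one_smul ℂ (1 : Op ι), mul_smul_comm, mul_one, ← onQubit_smul, ← onQubit_add]
  congr 1
  ext i j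
  fin_cases i <;> fin_cases j <;> simp [Pauli.matrix]

/-- The two control projections are orthogonal idempotents. Only `A` has to move past a projection,
so `B` is arbitrary. -/
theorem ctrl_mul (a : ι) {A : Op ι} (hA : ∀ M, Commute A (onQubit a M)) (B : Op ι) :
    ctrl a (A * B) = ctrl a A * ctrl a B := by
  have h00 : onQubit a !![1, 0; 0, 0] * onQubit a !![1, 0; 0, 0] = onQubit a !![1, 0; 0, 0] := by
    rw [onQubit_mul]
    congr 1
    ext i j
    fin_cases i <;> fin_cases j <;> simp
  have h11 : onQubit a !![0, 0; 0, 1] * onQubit a !![0, 0; 0, 1] = onQubit a !![0, 0; 0, 1] := by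
    rw [onQubit_mul]
    congr 1
    ext i j
    fin_cases i <;> fin_cases j <;> simp
  have h01 : onQubit a !![1, 0; 0, 0] * onQubit a !![0, 0; 0, 1] = 0 := by
    rw [onQubit_mul, ← onQubit_zero a]
    congr 1
    ext i j
    fin_cases i <;> fin_cases j <;> simp
  have h10 : onQubit a !![0, 0; 0, 1] * onQubit a !![1, 0; 0, 0] = 0 := by
    rw [onQubit_mul, ← onQubit_zero a]
    congr 1
    ext i j
    fin_cases i <;> fin_cases j <;> simp
  have e0 := (hA !![1, 0; 0, 0]).eq
  have e1 := (hA !![0, 0; 0, 1]).eq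
  simp only [ctrl]
  generalize onQubit a !![1, 0; 0, 0] = p at *
  generalize onQubit a !![0, 0; 0, 1] = q at *
  symm
  calc (p + q * A) * (p + q * B)
      = p * p + p * q * B + q * (A * p) + q * (A * q) * B := by noncomm_ring
    _ = p * p + p * q * B + q * p * A + q * q * A * B := by rw [e0, e1]; noncomm_ring
    _ = p + q * (A * B) := by rw [h00, h01, h10, h11]; noncomm_ring

/-- In the uncontrolled branch `V` and `W` cancel, so the basis change needs no control. This yields
controlled `Y` and `Z` from `CNOT`. -/
theorem ctrl_conj (a : ι) {A V W : Op ι} (hV : ∀ M, Commute V (onQubit a M)) (hVW : V * W = 1) :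
    ctrl a (V * A * W) = V * ctrl a A * W := by
  simp only [ctrl, mul_add, add_mul]
  rw [(hV _).eq, mul_assoc _ V W, hVW, mul_one, ← mul_assoc V, (hV _).eq]
  simp only [mul_assoc]

theorem commute_ctrl {a : ι} {A B : Op ι} (hB : ∀ M, Commute B (onQubit a M))
    (hAB : Commute B A) : Commute B (ctrl a A) :=
  (hB _).add_right ((hB _).mul_right hAB)

/-- Conjugation by a controlled involution turns `X` on the control into `X ⊗ A`. -/
theorem ctrl_mul_X_mul_ctrl (a : ι) {A : Op ι} (hA : ∀ M, Commute A (onQubit a M))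
    (hAA : A * A = 1) :
    ctrl a A * onQubit a Pauli.X.matrix * ctrl a A = A * onQubit a Pauli.X.matrix := by
  -- `X` exchanges the control projections, so `A` now acts on `|0⟩`; as `A² = 1`, this equals `A`
  -- times the original controlled operator.
  have h : onQubit a Pauli.X.matrix * ctrl a A = A * ctrl a A * onQubit a Pauli.X.matrix := by
    have e0 : onQubit a Pauli.X.matrix * onQubit a !![1, 0; 0, 0] =
        onQubit a !![0, 0; 0, 1] * onQubit a Pauli.X.matrix := by
      rw [onQubit_mul, onQubit_mul]
      congr 1
      ext i j
      fin_cases i <;> fin_cases j <;> simp [Pauli.matrix]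
    have e1 : onQubit a Pauli.X.matrix * onQubit a !![0, 0; 0, 1] =
        onQubit a !![1, 0; 0, 0] * onQubit a Pauli.X.matrix := by
      rw [onQubit_mul, onQubit_mul]
      congr 1
      ext i j
      fin_cases i <;> fin_cases j <;> simp [Pauli.matrix]
    have c0 := (hA !![1, 0; 0, 0]).eq
    have c1 := (hA !![0, 0; 0, 1]).eq
    have cX := (hA Pauli.X.matrix).eq
    simp only [ctrl]
    generalize onQubit a !![1, 0; 0, 0] = p at *
    generalize onQubit a !![0, 0; 0, 1] = q at *
    generalize onQubit a Pauli.X.matrix = x at *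
    calc x * (p + q * A) = x * p + x * q * A := by noncomm_ring
      _ = q * x + p * (x * A) := by rw [e0, e1]; noncomm_ring
      _ = p * A * x + q * (A * A) * x := by rw [← cX, hAA]; noncomm_ring
      _ = A * p * x + A * q * A * x := by rw [c0, c1]; noncomm_ring
      _ = A * (p + q * A) * x := by noncomm_ring
  rw [mul_assoc, h, ← mul_assoc, ← mul_assoc, ← (commute_ctrl hA (Commute.refl A)).eq,
    mul_assoc A, ← ctrl_mul a hA, hAA, ctrl_one, mul_one]

/-! ### Controlled Paulis are Clifford. -/

/-- The operators implemented exactly by circuits of Clifford gates. -/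
noncomputable def cliffordOps (ι : Type) [Fintype ι] [DecidableEq ι] : Submonoid (Op ι) where
  carrier := {U | ∃ c : Circuit ι, (∀ g ∈ c, g.IsClifford) ∧ c.op = U}
  one_mem' := ⟨[], by simp, rfl⟩
  mul_mem' := by
    rintro _ _ ⟨c, hc, rfl⟩ ⟨d, hd, rfl⟩
    refine ⟨c ++ d, fun g hg => ?_, by simp [Circuit.op]⟩
    exact (List.mem_append.1 hg).elim (hc g) (hd g)

theorem gate_op_mem_cliffordOps {g : Gate ι} (hg : g.IsClifford) : g.op ∈ cliffordOps ι :=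
  ⟨[g], by simpa using hg, by simp [Circuit.op]⟩

theorem onQubit_matH_mem (q : ι) : onQubit q matH ∈ cliffordOps ι :=
  gate_op_mem_cliffordOps (g := .H q) trivial

theorem onQubit_matS_mem (q : ι) : onQubit q matS ∈ cliffordOps ι :=
  gate_op_mem_cliffordOps (g := .S q) trivial

theorem ctrl_onQubit_pauli_mem {a q : ι} (h : a ≠ q) (s : Pauli) :
    ctrl a (onQubit q s.matrix) ∈ cliffordOps ι := by
  have hX : ctrl a (onQubit q Pauli.X.matrix) ∈ cliffordOps ι :=
    gate_op_mem_cliffordOps (g := .CNOT a q h) trivial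
  have hS := onQubit_matS_mem q
  have hH := onQubit_matH_mem q
  cases s with
  | I =>
    rw [Pauli.matrix, onQubit_one, ctrl_one]
    exact one_mem _
  | X => exact hX
  | Y =>
    rw [← matS_mul_X_mul_matS_cube, ← onQubit_mul, ← onQubit_mul,
      ctrl_conj a (fun M => commute_onQubit h.symm _ M)
        (by rw [onQubit_mul, matS_mul_matS_cube, onQubit_one]), ← onQubit_mul, ← onQubit_mul]
    exact mul_mem (mul_mem hS hX) (mul_mem (mul_mem hS hS) hS)
  | Z =>
    rw [← matH_mul_X_mul_matH, ← onQubit_mul, ← onQubit_mul,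
      ctrl_conj a (fun M => commute_onQubit h.symm _ M)
        (by rw [onQubit_mul, matH_mul_self, onQubit_one])]
    exact mul_mem (mul_mem hH hX) hH

theorem ctrl_tensorAll_pauli_mem {a : ι} {s : ι → Pauli} (hs : s a = .I) :
    ctrl a (tensorAll fun i => (s i).matrix) ∈ cliffordOps ι := by
  -- Building the Pauli one factor at a time turns the controlled Pauli into a product of two-qubit
  -- controlled Paulis.
  suffices h : ∀ t : Finset ι,
      ctrl a (tensorAll fun i => if i ∈ t then (s i).matrix else 1) ∈ cliffordOps ι by
    simpa using h Finset.univ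
  intro t
  induction t using Finset.induction_on with
  | empty =>
    simp only [Finset.notMem_empty, if_false, tensorAll_one, ctrl_one]
    exact one_mem _
  | insert q t hq ih =>
    have e : (tensorAll fun i => if i ∈ insert q t then (s i).matrix else 1) =
        onQubit q (s q).matrix * tensorAll fun i => if i ∈ t then (s i).matrix else 1 := by
      rw [onQubit, tensorAll_mul]
      congr 1
      ext1 i
      by_cases hi : i = q
      · subst hi
        simp [hq]
      · simp [hi]
    rw [e]
    by_cases ha : a = q
    · subst ha
      rwa [hs, Pauli.matrix, onQubit_one, one_mul]
    · rw [ctrl_mul a fun M => commute_onQubit (Ne.symm ha) _ M]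
      exact mul_mem (ctrl_onQubit_pauli_mem ha _) ih

/-- `A` is, up to sign, a Pauli operator that is trivial on the qubit `a`. -/
def IsSignedPauliOff (a : ι) (A : Op ι) : Prop :=
  ∃ s : ι → Pauli, s a = .I ∧
    (A = tensorAll (fun i => (s i).matrix) ∨ A = -tensorAll fun i => (s i).matrix)

theorem IsSignedPauliOff.commute_onQubit {a : ι} {A : Op ι} (h : IsSignedPauliOff a A)
    (M : Matrix (Fin 2) (Fin 2) ℂ) : Commute A (onQubit a M) := by
  obtain ⟨s, hs, rfl | rfl⟩ := h
  · exact commute_tensorAll_onQubit (by rw [hs, Pauli.matrix]) M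
  · exact (commute_tensorAll_onQubit (by rw [hs, Pauli.matrix]) M).neg_left

theorem IsSignedPauliOff.mul_self {a : ι} {A : Op ι} (h : IsSignedPauliOff a A) : A * A = 1 := by
  obtain ⟨s, hs, rfl | rfl⟩ := h <;>
    simp [tensorAll_mul, Pauli.matrix_mul_self, tensorAll_one]

theorem IsSignedPauliOff.ctrl_mem {a : ι} {A : Op ι} (h : IsSignedPauliOff a A) :
    ctrl a A ∈ cliffordOps ι := by
  obtain ⟨s, hs, rfl | rfl⟩ := h
  · exact ctrl_tensorAll_pauli_mem hs
  -- The controlled sign is `Z = S²` on the control.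
  · rw [← neg_one_mul, ctrl_mul a fun M => (Commute.one_left _).neg_left, ctrl_neg_one,
      ← matS_mul_self, ← onQubit_mul]
    exact mul_mem (mul_mem (onQubit_matS_mem a) (onQubit_matS_mem a))
      (ctrl_tensorAll_pauli_mem hs)

/-- The controlled operator with the control read in the `X` basis. -/
noncomputable def ctrlX (a : ι) (A : Op ι) : Op ι := onQubit a matH * ctrl a A * onQubit a matH

theorem IsSignedPauliOff.ctrlX_mem {a : ι} {A : Op ι} (h : IsSignedPauliOff a A) :
    ctrlX a A ∈ cliffordOps ι :=
  mul_mem (mul_mem (onQubit_matH_mem a) h.ctrl_mem) (onQubit_matH_mem a)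

theorem onQubit_matH_mul_self (a : ι) : onQubit a matH * onQubit a matH = 1 := by
  rw [onQubit_mul, matH_mul_self, onQubit_one]

theorem IsSignedPauliOff.ctrlX_mul_self {a : ι} {A : Op ι} (h : IsSignedPauliOff a A) :
    ctrlX a A * ctrlX a A = 1 := by
  have hc : ctrl a A * ctrl a A = 1 := by
    rw [← ctrl_mul a h.commute_onQubit, h.mul_self, ctrl_one]
  calc ctrlX a A * ctrlX a A
      = onQubit a matH * (ctrl a A * (onQubit a matH * onQubit a matH) * ctrl a A) *
          onQubit a matH := by simp only [ctrlX, mul_assoc]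
    _ = 1 := by rw [onQubit_matH_mul_self, mul_one, hc, mul_one, onQubit_matH_mul_self]

/-- `H` on the control exchanges `Z` and `X`, which reduces this to `ctrl_mul_X_mul_ctrl`. -/
theorem IsSignedPauliOff.ctrlX_conj_Z {a : ι} {A : Op ι} (h : IsSignedPauliOff a A) :
    ctrlX a A * onQubit a Pauli.Z.matrix * ctrlX a A = A * onQubit a Pauli.Z.matrix := by
  calc ctrlX a A * onQubit a Pauli.Z.matrix * ctrlX a A
      = onQubit a matH * (ctrl a A *
          (onQubit a matH * onQubit a Pauli.Z.matrix * onQubit a matH) * ctrl a A) *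
          onQubit a matH := by simp only [ctrlX, mul_assoc]
    _ = onQubit a matH * (A * onQubit a Pauli.X.matrix) * onQubit a matH := by
        rw [onQubit_mul, onQubit_mul, matH_mul_Z_mul_matH,
          ctrl_mul_X_mul_ctrl a h.commute_onQubit h.mul_self]
    _ = A * (onQubit a matH * onQubit a Pauli.X.matrix * onQubit a matH) := by
        rw [← mul_assoc, ← (h.commute_onQubit _).eq]
        simp only [mul_assoc]
    _ = A * onQubit a Pauli.Z.matrix := by
        rw [onQubit_mul, onQubit_mul, matH_mul_X_mul_matH]

theorem commute_ctrlX {a : ι} {A B : Op ι} (hB : ∀ M, Commute B (onQubit a M))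
    (hAB : Commute B A) : Commute B (ctrlX a A) :=
  ((hB _).mul_right (commute_ctrl hB hAB)).mul_right (hB _)

/-! ### Simultaneous Clifford conjugation, and its effect on rotations. -/

/-- Pairwise commuting signed Paulis `A j`, trivial on the distinct qubits `a k`, can be attached
to the operators `Z` on these qubits by conjugation with one Clifford operator. -/
theorem exists_clifford_conj {κ : Type} [DecidableEq κ] (a : κ → ι) (ha : a.Injective)
    (A : κ → Op ι) (hA : ∀ j k, IsSignedPauliOff (a k) (A j)) (hcomm : ∀ j k, Commute (A j) (A k))
    (t : Finset κ) :
    ∃ C ∈ cliffordOps ι, ∃ D ∈ cliffordOps ι, C * D = 1 ∧ D * C = 1 ∧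
      ∀ j, C * onQubit (a j) Pauli.Z.matrix * D =
        if j ∈ t then A j * onQubit (a j) Pauli.Z.matrix else onQubit (a j) Pauli.Z.matrix := by
  induction t using Finset.induction_on with
  | empty => exact ⟨1, one_mem _, 1, one_mem _, by simp⟩
  | insert k t hk ih =>
    obtain ⟨C, hC, D, hD, hCD, hDC, hconj⟩ := ih
    have hL := (hA k k).ctrlX_mul_self
    -- The new factor is its own inverse, so it serves on both sides.
    refine ⟨ctrlX (a k) (A k) * C, mul_mem (hA k k).ctrlX_mem hC, D * ctrlX (a k) (A k),
      mul_mem hD (hA k k).ctrlX_mem, ?_, ?_, fun j => ?_⟩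
    · rw [mul_assoc, ← mul_assoc C, hCD, one_mul, hL]
    · rw [mul_assoc, ← mul_assoc (ctrlX (a k) (A k)), hL, one_mul, hDC]
    · have e : ctrlX (a k) (A k) * C * onQubit (a j) Pauli.Z.matrix * (D * ctrlX (a k) (A k)) =
          ctrlX (a k) (A k) * (C * onQubit (a j) Pauli.Z.matrix * D) * ctrlX (a k) (A k) := by
        simp only [mul_assoc]
      rw [e, hconj]
      by_cases hj : j = k
      · subst hj
        rw [if_neg hk, if_pos (Finset.mem_insert_self _ _), (hA j j).ctrlX_conj_Z]
      -- For `j ≠ k` the new factor must leave the earlier result alone: it commutes with `Z` on `a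
      -- j`, where `A k` is trivial, and with `A j` by `hcomm`.
      · have hZ : Commute (onQubit (a j) Pauli.Z.matrix) (ctrlX (a k) (A k)) :=
          commute_ctrlX (fun M => CliffordT.commute_onQubit (ha.ne hj) _ M)
            ((hA k j).commute_onQubit _).symm
        have hP : Commute (A j) (ctrlX (a k) (A k)) :=
          commute_ctrlX (hA j k).commute_onQubit (hcomm j k)
        simp only [Finset.mem_insert, hj, false_or]
        split_ifs
        · rw [← (hP.mul_left hZ).eq, mul_assoc, hL, mul_one]
        · rw [← hZ.eq, mul_assoc, hL, mul_one]

theorem R_conj {C D : Op ι} (h : C * D = 1) (A : Op ι) : R (C * A * D) = C * R A * D := by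
  simp [R, mul_add, add_mul, h]

/-- The coefficients in `R` have sum `1` and difference `omega`, the two eigenvalues of `T`. -/
theorem R_onQubit_Z (q : ι) : R (onQubit q Pauli.Z.matrix) = onQubit q matT := by
  rw [R, ← onQubit_one q, ← onQubit_smul, ← onQubit_smul, ← onQubit_add]
  congr 1
  ext i j
  fin_cases i <;> fin_cases j <;> simp [Pauli.matrix, matT] <;> ring

theorem prod_map_conj {M κ : Type} [Monoid M] {C D : M} (hCD : C * D = 1) (hDC : D * C = 1)
    (f : κ → M) (l : List κ) :
    (l.map fun j => C * f j * D).prod = C * (l.map f).prod * D := by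
  induction l with
  | nil => simp [hCD]
  | cons j l ih =>
    rw [List.map_cons, List.prod_cons, ih, List.map_cons, List.prod_cons]
    calc C * f j * D * (C * (l.map f).prod * D)
        = C * f j * (D * C) * (l.map f).prod * D := by simp only [mul_assoc]
      _ = C * (f j * (l.map f).prod) * D := by rw [hDC, mul_one]; simp only [mul_assoc]

end Register

/-! ### Bounds on the `T`-depth. -/

section Depth

variable {ι : Type}

theorem SameCircuit.perm {c d : Circuit ι} (h : SameCircuit c d) : c.Perm d := by
  induction h with
  | refl => exact List.Perm.refl _
  | tail _ hstep ih =>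
    refine ih.trans ?_
    cases hstep with
    | swap a b g h _ => exact (List.Perm.swap h g b).append_left a

theorem tDepth_le_of_layered {c : Circuit ι} {k : ℕ} (h : Layered k c) : c.tDepth ≤ k :=
  Nat.sInf_le ⟨c, Relation.ReflTransGen.refl, h⟩

theorem tDepth_pos_of_T_mem {c : Circuit ι} {q : ι} (h : Gate.T q ∈ c) : 0 < c.tDepth := by
  refine Nat.pos_of_ne_zero fun h0 => ?_
  -- Attainment matters: `sInf` of an empty set of naturals would also be `0`.
  obtain ⟨d, hcd, hd⟩ : c.tDepth ∈ {k | ∃ d, SameCircuit c d ∧ Layered k d} :=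
    Nat.sInf_mem (exists_layered c)
  rw [h0] at hd
  cases hd with
  | clifford _ hC => exact hC _ (hcd.perm.subset h)

end Depth

/-! ### Data and ancilla registers. -/

section Ancilla

variable {α β : Type}

theorem tensorOp_mulVec [Fintype α] [DecidableEq α] [Fintype β] [DecidableEq β]
    (A : Op α) (B : Op β) (ψ : Ket α) (φ : Ket β) :
    tensorOp A B *ᵥ tensorKet ψ φ = tensorKet (A *ᵥ ψ) (B *ᵥ φ) := by
  ext x
  simp only [Matrix.mulVec, dotProduct, tensorOp, tensorKet, Finset.sum_mul_sum]
  -- A basis vector of the joint register is a pair of basis vectors, so the double sum becomes a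
  -- single one.
  rw [← Fintype.sum_prod_type', ← (Equiv.sumArrowEquivProdArrow α β (Fin 2)).sum_comp]
  refine Finset.sum_congr rfl fun y _ => ?_
  simp only [Equiv.sumArrowEquivProdArrow, Equiv.coe_fn_mk]
  ring

theorem tensorOp_tensorAll [Fintype α] [Fintype β] (σ : α → Matrix (Fin 2) (Fin 2) ℂ)
    (τ : β → Matrix (Fin 2) (Fin 2) ℂ) :
    tensorOp (tensorAll σ) (tensorAll τ) = tensorAll (Sum.elim σ τ) := by
  ext x y
  simp [tensorOp, tensorAll, Fintype.prod_sum_type]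

theorem tensorOp_mul [Fintype α] [DecidableEq α] [Fintype β] [DecidableEq β]
    (A A' : Op α) (B B' : Op β) :
    tensorOp A B * tensorOp A' B' = tensorOp (A * A') (B * B') := by
  ext x y
  simp only [Matrix.mul_apply, tensorOp, Finset.sum_mul_sum]
  rw [← Fintype.sum_prod_type', ← (Equiv.sumArrowEquivProdArrow α β (Fin 2)).sum_comp]
  refine Finset.sum_congr rfl fun z _ => ?_
  simp only [Equiv.sumArrowEquivProdArrow, Equiv.coe_fn_mk]
  ring

variable [Fintype α] [DecidableEq α] [Fintype β] [DecidableEq β]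

theorem tensorOp_one_onQubit (j : β) (M : Matrix (Fin 2) (Fin 2) ℂ) :
    tensorOp (1 : Op α) (onQubit j M) = onQubit (Sum.inr j) M := by
  rw [← tensorAll_one, onQubit, tensorOp_tensorAll, onQubit]
  congr 1
  ext1 i
  rcases i with i | i
  · simp
  · by_cases h : i = j
    · subst h
      simp
    · simp [h]

theorem tensorOp_onQubit (A : Op α) (j : β) (M : Matrix (Fin 2) (Fin 2) ℂ) :
    tensorOp A (onQubit j M) = tensorOp A 1 * onQubit (Sum.inr j) M := by
  rw [← tensorOp_one_onQubit, tensorOp_mul, mul_one, one_mul]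

theorem isSignedPauliOff_tensorOp_one {A : Op α} (h : A ∈ signedPaulis α) (j : β) :
    IsSignedPauliOff (Sum.inr j) (tensorOp A (1 : Op β)) := by
  have key (s : α → Pauli) : tensorOp (tensorAll fun i => (s i).matrix) (1 : Op β) =
      tensorAll fun i => (Sum.elim s (fun _ => Pauli.I) i).matrix := by
    rw [← tensorAll_one, tensorOp_tensorAll]
    congr 1
    ext1 i
    rcases i with i | i <;> simp [Pauli.matrix]
  rcases h with ⟨s, rfl⟩ | ⟨s, hs⟩
  · exact ⟨Sum.elim s fun _ => .I, rfl, .inl (key s)⟩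
  · refine ⟨Sum.elim s fun _ => .I, rfl, .inr ?_⟩
    rw [← key, ← hs]
    ext x y
    simp [tensorOp]

/-- Only the column of `|0⟩` is involved, and there `Z` and `1` have the same entries. -/
theorem onQubit_Z_mulVec_ketZero (j : β) :
    onQubit j Pauli.Z.matrix *ᵥ (ketZero : Ket β) = ketZero := by
  ext x
  rw [ketZero, Matrix.mulVec_single_one, Matrix.col_apply, onQubit, tensorAll]
  have h (i : β) : Function.update (fun _ : β => (1 : Matrix (Fin 2) (Fin 2) ℂ)) j
      Pauli.Z.matrix i (x i) 0 =
      (1 : Matrix (Fin 2) (Fin 2) ℂ) (x i) 0 := by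
    by_cases hi : i = j
    · subst hi
      rw [Function.update_self]
      generalize x i = b
      revert b
      simp [Fin.forall_fin_two, Pauli.matrix]
    · rw [Function.update_of_ne hi]
  simp only [h]
  have h1 := congrFun (congrFun (tensorAll_one (ι := β)) x) fun _ => 0
  rw [tensorAll] at h1
  rw [h1, Matrix.one_apply, Pi.single_apply]

theorem R_tensorOp_Z_mulVec (A : Op α) (j : β) (ψ : Ket α) :
    R (tensorOp A (onQubit j Pauli.Z.matrix)) *ᵥ tensorKet ψ ketZero =
      tensorKet (R A *ᵥ ψ) ketZero := by
  rw [R, R, Matrix.add_mulVec, Matrix.add_mulVec, Matrix.smul_mulVec, Matrix.smul_mulVec,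
    Matrix.smul_mulVec, Matrix.smul_mulVec, tensorOp_mulVec, onQubit_Z_mulVec_ketZero,
    Matrix.one_mulVec, Matrix.one_mulVec]
  ext x
  simp only [tensorKet, Pi.add_apply, Pi.smul_apply, smul_eq_mul]
  ring

theorem prod_R_tensorOp_Z_mulVec (A : β → Op α) (l : List β) (ψ : Ket α) :
    (l.map fun j => R (tensorOp (A j) (onQubit j Pauli.Z.matrix))).prod *ᵥ tensorKet ψ ketZero =
      tensorKet ((l.map fun j => R (A j)).prod *ᵥ ψ) ketZero := by
  induction l with
  | nil => simp
  | cons j l ih =>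
    rw [List.map_cons, List.map_cons, List.prod_cons, List.prod_cons, ← Matrix.mulVec_mulVec, ih,
      R_tensorOp_Z_mulVec, Matrix.mulVec_mulVec]

end Ancilla

end CliffordT

/-! ### Assembly of the circuit. -/

theorem theorem4 (n m : ℕ) (P : Fin m → CliffordT.Op (Fin n))
    (hP : ∀ j, P j ∈ CliffordT.signedPaulis (Fin n))
    (hcomm : ∀ i j, P i * P j = P j * P i) :
    ∃ c : CliffordT.Circuit (Fin n ⊕ Fin m),
      c.tDepth ≤ 1 ∧ (0 < m → c.tDepth = 1) ∧
      c.op = (List.ofFn fun j : Fin m => CliffordT.R (CliffordT.tensorOp (P j)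
        (CliffordT.onQubit j CliffordT.Pauli.Z.matrix))).prod ∧
      ∀ ψ : CliffordT.Ket (Fin n),
        c.op *ᵥ CliffordT.tensorKet ψ CliffordT.ketZero =
          CliffordT.tensorKet ((List.ofFn fun j : Fin m => CliffordT.R (P j)).prod *ᵥ ψ)
            CliffordT.ketZero := by
  open CliffordT in
  obtain ⟨_, ⟨c, hc, rfl⟩, _, ⟨d, hd, rfl⟩, hCD, hDC, hconj⟩ :=
    exists_clifford_conj (fun j : Fin m => (Sum.inr j : Fin n ⊕ Fin m)) Sum.inr_injective
      (fun j => tensorOp (P j) 1) (fun j k => isSignedPauliOff_tensorOp_one (hP j) k)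
      (fun j k => by
        rw [Commute, SemiconjBy, tensorOp_mul, tensorOp_mul, hcomm])
      Finset.univ
  open CliffordT in
  have hop : Circuit.op (c ++ ((List.finRange m).map Sum.inr).map Gate.T ++ d) =
      (List.ofFn fun j : Fin m => R (tensorOp (P j) (onQubit j Pauli.Z.matrix))).prod := by
    -- All rotations share the same conjugating pair, so the inner Cliffords cancel in the product
    -- and the `T` gates become adjacent.
    have h (j : Fin m) : R (tensorOp (P j) (onQubit j Pauli.Z.matrix)) =
        c.op * Gate.op (Gate.T (Sum.inr j)) * d.op := by
      have hj := hconj j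
      rw [if_pos (Finset.mem_univ j)] at hj
      rw [tensorOp_onQubit, ← hj, R_conj hCD, R_onQubit_Z, Gate.op]
    simp only [h, List.ofFn_eq_map, prod_map_conj hCD hDC]
    simp [Circuit.op, Function.comp_def, mul_assoc]
  have hle := CliffordT.tDepth_le_of_layered <|
    CliffordT.Layered.layer 0 c (((List.finRange m).map Sum.inr).map CliffordT.Gate.T) d hc
      ⟨_, (List.nodup_finRange m).map Sum.inr_injective, rfl⟩ (.clifford d hd)
  refine ⟨_, hle, fun hm => le_antisymm hle ?_, hop, fun ψ => ?_⟩
  · refine CliffordT.tDepth_pos_of_T_mem (q := Sum.inr ⟨0, hm⟩) ?_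
    simp
  · rw [hop, List.ofFn_eq_map, List.ofFn_eq_map, CliffordT.prod_R_tensorOp_Z_mulVec]
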